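/- For a topological space $X$ and $n\ge 1$ let $\mathrm{Sub}_n(X)$ be the set of all nonempty subsets of $X$ with at most $n$ elements, with the Vietoris topology, that is, the topology generated by the sets $\{S : S\subseteq U\}$ and $\{S : S\cap U\neq\emptyset\}$ with $U\subseteq X$ open (for the circle $X=S^1$ this is also the topology of the Hausdorff metric, and the quotient topology from the map $X^n\to\mathrm{Sub}_n(X)$, $(x_1,\dots,x_n)\mapsto\{x_1,\dots,x_n\}$). **Theorem (Borsuk–Bott).** The space $\mathrm{Sub}_3(S^1)$ of nonempty subsets of the circle $S^1$ with at most three elements is homeomorphic to the three-dimensional sphere $S^3=\{x\in\mathbb{R}^4 : \|x\|=1\}$. -/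

import Mathlib

/-- The set `Sub_n(X)` of nonempty subsets of `X` with at most `n` elements. The cardinality is
taken in `ℕ∞`, so infinite subsets are excluded. -/
def FiniteSubsetSpace (n : ℕ) (X : Type*) : Type _ :=
  {S : Set X // S.Nonempty ∧ S.encard ≤ n}

/-- The topology of `Sub_n(X)` by small movements of the points, with collisions and splittings
allowed: it is induced by the Vietoris topology on the powerset of `X`. If `U₁, …, U_k` are open
neighbourhoods of the points of `S = {x₁, …, x_k}`, then the sets `T` with `T ⊆ U₁ ∪ … ∪ U_k` and
`T ∩ U_i ≠ ∅` for all `i` form a basic neighbourhood of `S`. -/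
instance FiniteSubsetSpace.instTopologicalSpace (n : ℕ) (X : Type*) [TopologicalSpace X] :
    TopologicalSpace (FiniteSubsetSpace n X) :=
  TopologicalSpace.induced Subtype.val (TopologicalSpace.vietoris X)

open ComplexConjugate Topology

/-! An unordered triple on the circle is determined by its product `p` and its sum `s`, because the
second symmetric function is `p * conj s`. For fixed `p` the possible sums fill a deltoid, which `r
↦ 2r + p r̄²` parametrizes bijectively by the closed unit disc (`harmonic_injOn`,
`exists_circle_points`, `exists_disc_point`). Unordered triples thus form a solid torus with
coordinates `(p, r)`. Its boundary `‖r‖ = 1` consists of the triples `{a, a, b}` with `a = r`, and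
passing to subsets glues `{a, a, b}` to `{a, b, b}`.

To realize the quotient, let `u = p r̄` and `v = p + q` with `q = p² r̄³`, so that `p` and `q` are
the roots of `T² - vT + u³`, with `‖q‖ ≤ ‖p‖`. Inside the torus `p` is the strictly larger root and
is recovered from `(u, v)`; on the boundary the moduli agree, and exchanging the roots `a²b` and
`ab²` is exactly the gluing. Hence `(u, v)` meets each orbit of `(a, b) ↦ (c²a, c³b)`, `c > 0`, on
`ℂ² \ {0}` in the image of exactly one subset (`subset_eq_of_scaling`, `exists_scaling`). The orbit
space is the three-sphere, and compactness supplies the homeomorphism. -/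

theorem Complex.conj_mul_self_of_norm_eq_one {z : ℂ} (hz : ‖z‖ = 1) : conj z * z = 1 := by
  rw [mul_comm, Complex.mul_conj']; simp [hz]

theorem Complex.ne_zero_of_norm_eq_one {z : ℂ} (hz : ‖z‖ = 1) : z ≠ 0 := by
  rintro rfl; simp at hz

/-! ### The disc coordinate: injectivity, and triples from points of the disc -/

/-- For `‖p‖ = 1` the harmonic map `r ↦ 2 r + p r̄²` is injective on the closed unit disc. -/
theorem harmonic_injOn {p r s : ℂ} (hp : ‖p‖ = 1) (hr : ‖r‖ ≤ 1) (hs : ‖s‖ ≤ 1)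
    (h : 2 * r + p * conj r ^ 2 = 2 * s + p * conj s ^ 2) : r = s := by
  by_contra hne
  have hpos : 0 < ‖r - s‖ := norm_pos_iff.2 (sub_ne_zero.2 hne)
  have e : 2 * (r - s) = - (p * conj ((r - s) * (r + s))) := by
    simp only [map_mul, map_add, map_sub]; linear_combination h
  have e2 : 2 * ‖r - s‖ = ‖r - s‖ * ‖r + s‖ := by
    have := congrArg norm e
    simpa only [norm_neg, norm_mul, RCLike.norm_conj, hp, Complex.norm_ofNat, one_mul] using this
  have h2 : ‖r + s‖ = 2 := by
    apply mul_left_cancel₀ hpos.ne'; linarith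
  -- Two points of the unit disc whose sum has norm 2 must coincide.
  have par := parallelogram_law_with_norm ℝ r s
  have : ‖r‖ * ‖r‖ ≤ 1 := by nlinarith [norm_nonneg r]
  have : ‖s‖ * ‖s‖ ≤ 1 := by nlinarith [norm_nonneg s]
  rw [h2] at par
  nlinarith

theorem normSq_sub_sub_normSq_one_sub (w r : ℂ) :
    ‖w - r‖ ^ 2 - ‖1 - conj r * w‖ ^ 2 = (‖w‖ ^ 2 - 1) * (1 - ‖r‖ ^ 2) := by
  simp only [← Complex.normSq_eq_norm_sq, Complex.normSq_apply]
  simp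
  ring

/-- The roots of a Blaschke equation of degree three lie on the unit circle. -/
theorem norm_eq_one_of_blaschke {p r w : ℂ} (hp : ‖p‖ = 1) (hr : ‖r‖ ≤ 1)
    (h : w * (w - r) ^ 2 = p * (1 - conj r * w) ^ 2) : ‖w‖ = 1 := by
  have hn : ‖w‖ * ‖w - r‖ ^ 2 = ‖1 - conj r * w‖ ^ 2 := by
    have := congrArg norm h
    simpa only [norm_mul, norm_pow, hp, one_mul] using this
  have hk := normSq_sub_sub_normSq_one_sub w r
  rw [← hn] at hk
  have hr2 : ‖r‖ ^ 2 ≤ 1 := by nlinarith [norm_nonneg r]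
  have hw := norm_nonneg w
  have hq := sq_nonneg ‖w - r‖
  by_contra hne
  -- Both summands are nonnegative, so both vanish: `w = r` lies on the circle after all.
  have h0 : (‖w‖ + 1) * (1 - ‖r‖ ^ 2) + ‖w - r‖ ^ 2 = 0 := by
    apply mul_left_cancel₀ (sub_ne_zero.2 hne)
    linear_combination -hk
  have h1 : 0 ≤ (‖w‖ + 1) * (1 - ‖r‖ ^ 2) := mul_nonneg (by linarith) (by linarith)
  have h2 : ‖w - r‖ ^ 2 = 0 := by linarith
  have h3 : w = r := by
    rw [sq_eq_zero_iff, norm_eq_zero, sub_eq_zero] at h2; exact h2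
  have h4 : 1 - ‖r‖ ^ 2 = 0 := by
    have : (‖w‖ + 1) * (1 - ‖r‖ ^ 2) = 0 := by linarith
    rcases mul_eq_zero.1 this with h | h
    · linarith
    · exact h
  rw [h3] at hne
  apply hne
  have : (‖r‖ - 1) * (‖r‖ + 1) = 0 := by linarith
  rcases mul_eq_zero.1 this with h | h
  · linarith
  · linarith [norm_nonneg r]

/-- The cubic of a triple becomes the equation `B(w) = p` for the Blaschke product `B(w) = w ((w -
r) / (1 - r̄ w))²`, cleared of denominators; this is where the formula for `s` comes from. -/
theorem cubic_eq_blaschke {p r s : ℂ} (hp : ‖p‖ = 1) (hs : 2 * r + p * conj r ^ 2 = s) (w : ℂ) :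
    w ^ 3 - s * w ^ 2 + p * conj s * w - p = w * (w - r) ^ 2 - p * (1 - conj r * w) ^ 2 := by
  subst hs
  simp only [map_add, map_mul, map_pow, Complex.conj_conj, map_ofNat]
  linear_combination w * r ^ 2 * Complex.conj_mul_self_of_norm_eq_one hp

/-- The second elementary symmetric function on the torus in terms of the other two. -/
theorem esymm_two_of_norm_eq_one {x y z : ℂ} (hx : ‖x‖ = 1) (hy : ‖y‖ = 1) (hz : ‖z‖ = 1) :
    x * y + y * z + z * x = x * y * z * conj (x + y + z) := by
  have hx' := Complex.conj_mul_self_of_norm_eq_one hx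
  have hy' := Complex.conj_mul_self_of_norm_eq_one hy
  have hz' := Complex.conj_mul_self_of_norm_eq_one hz
  simp only [map_add]
  linear_combination -y * z * hx' - x * z * hy' - x * y * hz'

theorem exists_roots_of_cubic (a b c : ℂ) :
    ∃ x y z : ℂ, x + y + z = a ∧ x * y + y * z + z * x = b ∧ x * y * z = c := by
  obtain ⟨x, hx⟩ : ∃ x : ℂ, x ^ 3 - a * x ^ 2 + b * x - c = 0 := by
    have hd : (Polynomial.X ^ 3 - Polynomial.C a * Polynomial.X ^ 2 +
        Polynomial.C b * Polynomial.X - Polynomial.C c : Polynomial ℂ).degree = 3 := by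
      compute_degree!
    obtain ⟨x, hx⟩ := IsAlgClosed.exists_root _ (hd.trans_ne (by decide))
    exact ⟨x, by simpa [Polynomial.IsRoot] using hx⟩
  obtain ⟨y, hy⟩ : ∃ y : ℂ, y ^ 2 - (a - x) * y + (b - x * (a - x)) = 0 := by
    have hd : (Polynomial.X ^ 2 - Polynomial.C (a - x) * Polynomial.X +
        Polynomial.C (b - x * (a - x)) : Polynomial ℂ).degree = 2 := by
      compute_degree!
    obtain ⟨x, hx⟩ := IsAlgClosed.exists_root _ (hd.trans_ne (by decide))
    exact ⟨x, by simpa [Polynomial.IsRoot] using hx⟩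
  exact ⟨x, y, a - x - y, by ring, by linear_combination -hy, by
    linear_combination hx - x * hy⟩

theorem exists_circle_points {p r : ℂ} (hp : ‖p‖ = 1) (hr : ‖r‖ ≤ 1) :
    ∃ x y z : ℂ, ‖x‖ = 1 ∧ ‖y‖ = 1 ∧ ‖z‖ = 1 ∧ x * y * z = p ∧
      2 * r + p * conj r ^ 2 = x + y + z := by
  obtain ⟨x, y, z, h1, h2, h3⟩ :=
    exists_roots_of_cubic (2 * r + p * conj r ^ 2) (p * conj (2 * r + p * conj r ^ 2)) p
  have key : ∀ w : ℂ, (w - x) * (w - y) * (w - z) = 0 → ‖w‖ = 1 := by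
    intro w hw
    apply norm_eq_one_of_blaschke hp hr
    have := cubic_eq_blaschke hp rfl w (r := r)
    linear_combination hw - this + w ^ 2 * h1 - w * h2 + h3
  exact ⟨x, y, z, key x (by ring), key y (by ring), key z (by ring), h3, h1.symm⟩

/-! ### Existence of the disc coordinate by minimization -/

/-- Variational inequality at a minimum of a real cubic polynomial on `[0, 1]`. -/
theorem nonneg_of_forall_cubic_nonneg {a b c : ℝ}
    (h : ∀ t : ℝ, 0 < t → t ≤ 1 → 0 ≤ t * a + t ^ 2 * b + t ^ 3 * c) : 0 ≤ a := by
  by_contra! ha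
  set m := |b| + |c| with hm
  have hb := le_abs_self b
  have hc := le_abs_self c
  have hb0 := abs_nonneg b
  have hc0 := abs_nonneg c
  set t := min 1 (-a / (2 * (m + 1))) with ht
  have hpos : 0 < t := lt_min one_pos (by apply div_pos <;> linarith)
  have h1 : t ≤ 1 := min_le_left _ _
  have h2 : t * (m + 1) ≤ -a / 2 := by
    have := min_le_right 1 (-a / (2 * (m + 1)))
    rw [← ht, le_div_iff₀ (by linarith)] at this
    linarith
  have h3 := h t hpos h1
  have h4 : 0 ≤ a + t * b + t ^ 2 * c := by
    by_contra! h5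
    nlinarith
  have h6 : t * b ≤ t * |b| := by gcongr
  have h7 : t ^ 2 * c ≤ t * |c| := by
    calc t ^ 2 * c ≤ t ^ 2 * |c| := by gcongr
      _ ≤ t * |c| := by gcongr; nlinarith
  nlinarith

/-- The left side of the last equation is the gradient of `‖r‖² + Re(p̄ r³)/3 - Re(s̄ r)`. A minimum
over the closed disc exists, and `m` is its Lagrange multiplier. -/
theorem exists_disc_gradient (p s : ℂ) :
    ∃ r : ℂ, ‖r‖ ≤ 1 ∧ ∃ m : ℝ, 0 ≤ m ∧ (m = 0 ∨ ‖r‖ = 1) ∧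
      2 * r + p * conj r ^ 2 - s = - (m * r) := by
  have hcont : Continuous fun r : ℂ ↦
      ‖r‖ ^ 2 + (conj p * r ^ 3).re / 3 - (conj s * r).re := by fun_prop
  obtain ⟨r, hr, hmin⟩ := (isCompact_closedBall (0 : ℂ) 1).exists_isMinOn
    ⟨0, by simp⟩ hcont.continuousOn
  rw [mem_closedBall_zero_iff] at hr
  set g := 2 * r + p * conj r ^ 2 - s with hg
  have key : ∀ d : ℂ, ‖r + d‖ ≤ 1 → 0 ≤ (conj g * d).re := by
    intro d hd
    apply nonneg_of_forall_cubic_nonneg (b := ‖d‖ ^ 2 + (conj p * r * d ^ 2).re)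
      (c := (conj p * d ^ 3).re / 3)
    intro t ht ht1
    have hmem : r + t * d ∈ Metric.closedBall (0 : ℂ) 1 := by
      have := (convex_closedBall (0 : ℂ) 1) (mem_closedBall_zero_iff.2 hr)
        (mem_closedBall_zero_iff.2 hd) (sub_nonneg.2 ht1) ht.le (by ring)
      convert this using 1
      simp only [Complex.real_smul]; push_cast; ring
    have := hmin hmem
    simp only [Set.mem_ofPred_eq] at this
    have e : ‖r + t * d‖ ^ 2 + (conj p * (r + t * d) ^ 3).re / 3 - (conj s * (r + t * d)).re
        = ‖r‖ ^ 2 + (conj p * r ^ 3).re / 3 - (conj s * r).re + (t * (conj g * d).re +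
          t ^ 2 * (‖d‖ ^ 2 + (conj p * r * d ^ 2).re) + t ^ 3 * ((conj p * d ^ 3).re / 3)) := by
      rw [hg]
      simp only [← Complex.normSq_eq_norm_sq, Complex.normSq_apply]
      simp [pow_succ]
      ring
    linarith
  by_cases hg0 : g = 0
  · exact ⟨r, hr, 0, le_rfl, .inl rfl, by simpa [hg] using hg0⟩
  have hgp : 0 < ‖g‖ := norm_pos_iff.2 hg0
  have hgc : (‖g‖ : ℂ) ≠ 0 := by exact_mod_cast hgp.ne'
  have h1 : (conj g * r).re ≤ -‖g‖ := by
    -- The competitor is `-g/‖g‖`, where the linear functional given by `g` is least on the disc;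
    -- equality in Cauchy–Schwarz will then give `g = -‖g‖ r`.
    have h := key (-r - g / ‖g‖) (by
      rw [show r + (-r - g / ‖g‖) = - (g / ‖g‖) by ring]
      simp [hg0])
    have e : conj g * (-r - g / ‖g‖) = -(conj g * r) - ‖g‖ := by
      field_simp
      linear_combination -Complex.mul_conj' g
    rw [e] at h
    simp only [Complex.sub_re, Complex.neg_re, Complex.ofReal_re] at h
    linarith
  have hr1 : ‖r‖ = 1 := by
    refine le_antisymm hr ?_
    have h2 : |(conj g * r).re| ≤ ‖g‖ * ‖r‖ := by
      simpa using Complex.abs_re_le_norm (conj g * r)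
    have h3 := (abs_le.1 h2).1
    nlinarith
  refine ⟨r, hr, ‖g‖, norm_nonneg g, .inr hr1, ?_⟩
  have h4 : ‖g + ‖g‖ * r‖ ^ 2 = ‖g‖ ^ 2 + ‖g‖ ^ 2 * ‖r‖ ^ 2 + 2 * ‖g‖ * (conj g * r).re := by
    simp only [← Complex.normSq_eq_norm_sq, Complex.normSq_add, Complex.normSq_mul,
      Complex.normSq_ofReal]
    simp [Complex.normSq_eq_norm_sq]
    ring
  have h5 : ‖g + ‖g‖ * r‖ = 0 := by
    rw [hr1] at h4
    rw [← sq_eq_zero_iff]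
    nlinarith [sq_nonneg ‖g + ‖g‖ * r‖]
  rw [norm_eq_zero] at h5
  linear_combination h5

/-- A positive multiplier would put `s` outside the deltoid, and the cubic would then have a root `k
r` with `k > 1`, although its roots `x`, `y`, `z` have modulus one. -/
theorem exists_disc_point {x y z : ℂ} (hx : ‖x‖ = 1) (hy : ‖y‖ = 1) (hz : ‖z‖ = 1) :
    ∃ r : ℂ, ‖r‖ ≤ 1 ∧ 2 * r + x * y * z * conj r ^ 2 = x + y + z := by
  obtain ⟨r, hr, m, hm, hm0, h⟩ := exists_disc_gradient (x * y * z) (x + y + z)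
  refine ⟨r, hr, ?_⟩
  suffices hm : m = 0 by subst hm; simpa [sub_eq_zero] using h
  rcases hm0 with hm0 | hr1
  · exact hm0
  by_contra hne
  have hm' : 0 < m := lt_of_le_of_ne hm (Ne.symm hne)
  -- `k` below is the larger root of `(k - 1)² = m k`, a factor of the cubic evaluated at `k r`.
  set d := √(m ^ 2 + 4 * m) with hd
  have hd2 : d ^ 2 = m ^ 2 + 4 * m := Real.sq_sqrt (by positivity)
  have hd0 : 0 ≤ d := Real.sqrt_nonneg _
  set k := (2 + m + d) / 2 with hk
  have hk1 : 1 < k := by linarith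
  have hk2 : (k - 1) ^ 2 = m * k := by rw [hk]; linear_combination hd2 / 4
  have hk2' : ((k : ℂ) - 1) ^ 2 = m * k := by exact_mod_cast hk2
  have hrr := Complex.conj_mul_self_of_norm_eq_one hr1
  have hs := h
  have hsc : 2 * conj r + conj (x * y * z) * r ^ 2 - conj (x + y + z) = -(m * conj r) := by
    have := congrArg conj h
    simpa only [map_add, map_sub, map_mul, map_neg, map_pow, Complex.conj_conj, map_ofNat,
      Complex.conj_ofReal] using this
  have hp : ‖x * y * z‖ = 1 := by simp [hx, hy, hz]
  have hpp := Complex.conj_mul_self_of_norm_eq_one hp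
  have he2 := esymm_two_of_norm_eq_one hx hy hz
  generalize hpdef : x * y * z = p at *
  generalize hsdef : x + y + z = s at *
  have hzero : (k * r - x) * (k * r - y) * (k * r - z) = 0 := by
    have e1 : (k * r - x) * (k * r - y) * (k * r - z)
        = (k * r) ^ 3 - s * (k * r) ^ 2 + p * conj s * (k * r) - p := by
      rw [← he2, ← hsdef, ← hpdef]; ring
    rw [e1]
    have es : s = (2 + m) * r + p * conj r ^ 2 := by linear_combination -hs
    have es' : p * conj s = (2 + m) * (p * conj r) + r ^ 2 := by
      linear_combination -p * hsc + r ^ 2 * hpp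
    rw [es', es]
    have : (k * r) ^ 3 - ((2 + m) * r + p * conj r ^ 2) * (k * r) ^ 2
        + ((2 + m) * (p * conj r) + r ^ 2) * (k * r) - p
        = ((k - 1) ^ 2 - m * k) * (k * r ^ 3 - p) := by
      linear_combination (p * (2 + m) * k - p * k ^ 2 * (conj r * r + 1)) * hrr
    rw [this, hk2']; ring
  have hkr : ∀ w : ℂ, ‖w‖ = 1 → k * r - w ≠ 0 := by
    intro w hw h0
    have := congrArg norm (sub_eq_zero.1 h0)
    rw [norm_mul, hr1, hw, Complex.norm_real, Real.norm_of_nonneg (by linarith)] at this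
    linarith
  simp only [mul_eq_zero, hkr x hx, hkr y hy, hkr z hz, or_self] at hzero

/-! ### Sum and product determine a triple on the circle -/

theorem triple_subset_of_sum_prod_eq {x y z x' y' z' : ℂ} (hx : ‖x‖ = 1) (hy : ‖y‖ = 1)
    (hz : ‖z‖ = 1) (hx' : ‖x'‖ = 1) (hy' : ‖y'‖ = 1) (hz' : ‖z'‖ = 1)
    (hs : x + y + z = x' + y' + z') (hp : x * y * z = x' * y' * z') :
    ({x, y, z} : Set ℂ) ⊆ {x', y', z'} := by
  have h := esymm_two_of_norm_eq_one hx hy hz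
  rw [hs, hp, ← esymm_two_of_norm_eq_one hx' hy' hz'] at h
  have key : ∀ w, (w - x) * (w - y) * (w - z) = 0 → w ∈ ({x', y', z'} : Set ℂ) := by
    intro w hw
    have : (w - x') * (w - y') * (w - z') = 0 := by
      linear_combination hw + w ^ 2 * hs - w * h + hp
    simpa [sub_eq_zero, or_assoc] using this
  rintro w (rfl | rfl | rfl) <;> exact key _ (by ring)

theorem triple_eq_of_sum_prod_eq {x y z x' y' z' : ℂ} (hx : ‖x‖ = 1) (hy : ‖y‖ = 1)
    (hz : ‖z‖ = 1) (hx' : ‖x'‖ = 1) (hy' : ‖y'‖ = 1) (hz' : ‖z'‖ = 1)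
    (hs : x + y + z = x' + y' + z') (hp : x * y * z = x' * y' * z') :
    ({x, y, z} : Set ℂ) = {x', y', z'} :=
  (triple_subset_of_sum_prod_eq hx hy hz hx' hy' hz' hs hp).antisymm
    (triple_subset_of_sum_prod_eq hx' hy' hz' hx hy hz hs.symm hp.symm)

/-- The triple attached to a boundary point of the disc has a double point. -/
theorem triple_eq_pair_of_norm_eq_one {x y z r : ℂ} (hx : ‖x‖ = 1) (hy : ‖y‖ = 1)
    (hz : ‖z‖ = 1) (hr : ‖r‖ = 1) (h : 2 * r + x * y * z * conj r ^ 2 = x + y + z) :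
    ({x, y, z} : Set ℂ) = {r, x * y * z * conj r ^ 2} := by
  have e := triple_eq_of_sum_prod_eq hx hy hz hr hr (z' := x * y * z * conj r ^ 2)
    (by simp [hx, hy, hz, hr]) (by linear_combination -h) (by
      have := Complex.conj_mul_self_of_norm_eq_one hr
      linear_combination -(x * y * z * (conj r * r + 1)) * this)
  rw [e]; simp

/-! ### Radial power maps, used to turn the weights 2 and 3 into the common weight 6 -/

theorem mul_norm_pow_injective (n : ℕ) : Function.Injective fun z : ℂ ↦ z * (‖z‖ : ℂ) ^ n := by
  intro z w h
  have hn : ‖z‖ = ‖w‖ := by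
    have := congrArg norm h
    simp only [norm_mul, norm_pow, Complex.norm_real, norm_norm] at this
    rw [← pow_succ', ← pow_succ'] at this
    exact (pow_left_inj₀ (norm_nonneg z) (norm_nonneg w) n.succ_ne_zero).1 this
  simp only [hn] at h
  by_cases hw : w = 0
  · rw [hw, norm_zero, norm_eq_zero] at hn
    rw [hn, hw]
  · exact mul_right_cancel₀ (pow_ne_zero _ (by simpa using hw)) h

theorem mul_norm_pow_surjective (n : ℕ) : Function.Surjective fun z : ℂ ↦ z * (‖z‖ : ℂ) ^ n := by
  intro a
  by_cases ha : a = 0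
  · exact ⟨0, by simp [ha]⟩
  have hpos : 0 < ‖a‖ := norm_pos_iff.2 ha
  set t := ‖a‖ ^ ((n + 1 : ℕ) : ℝ)⁻¹ with ht
  have htp : 0 < t := Real.rpow_pos_of_pos hpos _
  have htn : t ^ (n + 1) = ‖a‖ := Real.rpow_inv_natCast_pow hpos.le (by simp)
  refine ⟨a / ‖a‖ * t, ?_⟩
  have : ‖a / ‖a‖ * t‖ = t := by
    simp [ha, abs_of_pos htp]
  simp only [this]
  have hc : (‖a‖ : ℂ) ≠ 0 := by exact_mod_cast hpos.ne'
  rw [mul_assoc, ← pow_succ', ← Complex.ofReal_pow, htn]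
  field_simp

/-! ### Topology of finite subset spaces -/

theorem FiniteSubsetSpace.isOpen_subset {n : ℕ} {X : Type*} [TopologicalSpace X] {U : Set X}
    (hU : IsOpen U) : IsOpen {S : FiniteSubsetSpace n X | S.1 ⊆ U} :=
  isOpen_induced (t := TopologicalSpace.vietoris X) hU.powerset_vietoris

theorem FiniteSubsetSpace.isOpen_inter_nonempty {n : ℕ} {X : Type*} [TopologicalSpace X]
    {U : Set X} (hU : IsOpen U) : IsOpen {S : FiniteSubsetSpace n X | (S.1 ∩ U).Nonempty} :=
  isOpen_induced (t := TopologicalSpace.vietoris X)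
    (TopologicalSpace.vietoris.isOpen_inter_nonempty_of_isOpen hU)

/-- A point of `S` outside the finite set `T` has a neighbourhood `U` disjoint from a neighbourhood
`V` of `T`; meeting `U` and lying in `V` are then incompatible open conditions. -/
instance FiniteSubsetSpace.instT2Space (n : ℕ) (X : Type*) [TopologicalSpace X] [T2Space X] :
    T2Space (FiniteSubsetSpace n X) := by
  have hfin (S : FiniteSubsetSpace n X) : S.1.Finite :=
    Set.finite_of_encard_le_coe S.2.2
  have key (S T : FiniteSubsetSpace n X) (h : ¬ S.1 ⊆ T.1) :
      ∃ u v : Set (FiniteSubsetSpace n X), IsOpen u ∧ IsOpen v ∧ S ∈ u ∧ T ∈ v ∧ Disjoint u v := by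
    obtain ⟨x, hxS, hxT⟩ := Set.not_subset.1 h
    obtain ⟨U, V, hU, hV, hxU, hTV, hUV⟩ := SeparatedNhds.of_isCompact_isCompact
      (isCompact_singleton (x := x)) (hfin T).isCompact (Set.disjoint_singleton_left.2 hxT)
    refine ⟨_, _, isOpen_inter_nonempty hU, isOpen_subset hV, ⟨x, hxS, hxU rfl⟩, hTV, ?_⟩
    rw [Set.disjoint_left]
    rintro R ⟨y, hyR, hyU⟩ hRV
    exact Set.disjoint_left.1 hUV hyU (hRV hyR)
  refine ⟨fun S T hne ↦ ?_⟩
  by_cases h : S.1 ⊆ T.1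
  · have h' : ¬ T.1 ⊆ S.1 := fun h' ↦ hne (Subtype.ext (h.antisymm h'))
    obtain ⟨u, v, hu, hv, hTu, hSv, huv⟩ := key T S h'
    exact ⟨v, u, hv, hu, hSv, hTu, huv.symm⟩
  · exact key S T h

/-- The subset formed by the three points `x`, `y`, `z`, which may coincide. -/
def FiniteSubsetSpace.triple {X : Type*} (x y z : X) : FiniteSubsetSpace 3 X :=
  ⟨{x, y, z}, Set.insert_nonempty _ _, by
    calc ({x, y, z} : Set X).encard ≤ ({y, z} : Set X).encard + 1 := Set.encard_insert_le _ _
      _ ≤ (({z} : Set X).encard + 1) + 1 := by gcongr; exact Set.encard_insert_le _ _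
      _ = ((3 : ℕ) : ℕ∞) := by rw [Set.encard_singleton]; norm_num⟩

theorem Set.encard_sdiff_singleton_le {X : Type*} {S : Set X} {x : X} {n : ℕ∞} (hx : x ∈ S)
    (h : S.encard ≤ n + 1) : (S \ {x}).encard ≤ n := by
  rw [← Set.encard_sdiff_singleton_add_one hx] at h
  exact (ENat.add_le_add_iff_right ENat.one_ne_top).1 h

theorem FiniteSubsetSpace.exists_eq_triple {X : Type*} (S : FiniteSubsetSpace 3 X) :
    ∃ x y z, triple x y z = S := by
  obtain ⟨S, ⟨x, hx⟩, hc⟩ := S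
  suffices h : ∃ y z, ({x, y, z} : Set X) = S by
    obtain ⟨y, z, h⟩ := h
    exact ⟨x, y, z, Subtype.ext h⟩
  have hins : insert x (S \ {x}) = S := Set.insert_sdiff_self_of_mem hx
  have h2 : (S \ {x}).encard ≤ 1 + 1 :=
    Set.encard_sdiff_singleton_le hx (hc.trans (by norm_num))
  rcases (S \ {x}).eq_empty_or_nonempty with he | ⟨y, hy⟩
  · exact ⟨x, x, by rw [← hins, he]; simp⟩
  have hins' : insert y ((S \ {x}) \ {y}) = S \ {x} := Set.insert_sdiff_self_of_mem hy
  rcases Set.encard_le_one_iff_eq.1 (Set.encard_sdiff_singleton_le hy h2) with he | ⟨z, hz⟩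
  · exact ⟨y, y, by rw [← hins, ← hins', he]; simp⟩
  · exact ⟨y, z, by rw [← hins, ← hins', hz]⟩

theorem FiniteSubsetSpace.continuous_triple {X Y : Type*} [TopologicalSpace X]
    [TopologicalSpace Y] {f g h : Y → X} (hf : Continuous f) (hg : Continuous g)
    (hh : Continuous h) : Continuous fun y ↦ triple (f y) (g y) (h y) := by
  refine continuous_induced_rng.2 (continuous_generateFrom_iff.2 ?_)
  rintro _ (⟨U, hU, rfl⟩ | ⟨U, hU, rfl⟩)
  · have : ((fun y ↦ (triple (f y) (g y) (h y)).1) ⁻¹' U.powerset) =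
        f ⁻¹' U ∩ (g ⁻¹' U ∩ h ⁻¹' U) := by
      ext y; simp [triple, Set.insert_subset_iff]
    exact this ▸ (hU.preimage hf).inter ((hU.preimage hg).inter (hU.preimage hh))
  · have : ((fun y ↦ (triple (f y) (g y) (h y)).1) ⁻¹' {s | (s ∩ U).Nonempty}) =
        f ⁻¹' U ∪ (g ⁻¹' U ∪ h ⁻¹' U) := by
      ext y; simp [triple, Set.inter_nonempty]
    exact this ▸ (hU.preimage hf).union ((hU.preimage hg).union (hU.preimage hh))

/-- Two continuous surjections from a compact space onto Hausdorff spaces with the same fibres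
have homeomorphic targets. -/
theorem nonempty_homeomorph_of_same_fibres {K X Y : Type*} [TopologicalSpace K] [CompactSpace K]
    [TopologicalSpace X] [T2Space X] [TopologicalSpace Y] [T2Space Y] {f : K → X} {g : K → Y}
    (hf : Continuous f) (hg : Continuous g) (hf' : Function.Surjective f)
    (hg' : Function.Surjective g) (h : ∀ a b, f a = f b ↔ g a = g b) : Nonempty (X ≃ₜ Y) := by
  let F : C(K, X) := ⟨f, hf⟩
  let G : C(K, Y) := ⟨g, hg⟩
  have hF : IsQuotientMap F := hf.isClosedMap.isQuotientMap hf hf'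
  have hG : IsQuotientMap G := hg.isClosedMap.isQuotientMap hg hg'
  have e : Setoid.ker F = Setoid.ker G := by ext a b; exact h a b
  have k := hG.homeomorph
  rw [← e] at k
  exact ⟨hF.homeomorph.symm.trans k⟩

/-! ### The compact space of triples and its coordinates -/

/-- Triples of points on the circle together with the disc coordinate of their centre. -/
def tripleSet : Set ((Circle × Circle × Circle) × ℂ) :=
  {k | ‖k.2‖ ≤ 1 ∧
    2 * k.2 + k.1.1 * k.1.2.1 * k.1.2.2 * conj k.2 ^ 2 = k.1.1 + k.1.2.1 + k.1.2.2}

/-- The space of triples of points on the circle with the disc coordinate of their centre. -/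
abbrev TripleSpace : Type := tripleSet

theorem isCompact_tripleSet : IsCompact tripleSet := by
  have hc : Continuous fun z : Circle ↦ (z : ℂ) := continuous_subtype_val
  have h1 : Continuous fun k : (Circle × Circle × Circle) × ℂ ↦ (k.1.1 : ℂ) :=
    hc.comp (by fun_prop)
  have h2 : Continuous fun k : (Circle × Circle × Circle) × ℂ ↦ (k.1.2.1 : ℂ) :=
    hc.comp (by fun_prop)
  have h3 : Continuous fun k : (Circle × Circle × Circle) × ℂ ↦ (k.1.2.2 : ℂ) :=
    hc.comp (by fun_prop)
  have h4 : Continuous fun k : (Circle × Circle × Circle) × ℂ ↦ conj k.2 :=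
    Complex.continuous_conj.comp continuous_snd
  refine ((isCompact_univ (X := Circle × Circle × Circle)).prod
    (isCompact_closedBall (0 : ℂ) 1)).of_isClosed_subset ?_ ?_
  · exact IsClosed.inter (isClosed_le continuous_snd.norm continuous_const)
      (isClosed_eq ((continuous_const.mul continuous_snd).add (((h1.mul h2).mul h3).mul (h4.pow 2)))
        ((h1.add h2).add h3))
  · intro k hk
    exact ⟨trivial, mem_closedBall_zero_iff.2 hk.1⟩

namespace TripleSpace

instance : CompactSpace TripleSpace := isCompact_iff_compactSpace.1 isCompact_tripleSet

/-- The first point. -/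
def x (k : TripleSpace) : ℂ := k.1.1.1

/-- The second point. -/
def y (k : TripleSpace) : ℂ := k.1.1.2.1

/-- The third point. -/
def z (k : TripleSpace) : ℂ := k.1.1.2.2

/-- The disc coordinate. -/
def r (k : TripleSpace) : ℂ := k.1.2

@[simp]
theorem norm_x (k : TripleSpace) : ‖k.x‖ = 1 := Circle.norm_coe _

@[simp]
theorem norm_y (k : TripleSpace) : ‖k.y‖ = 1 := Circle.norm_coe _

@[simp]
theorem norm_z (k : TripleSpace) : ‖k.z‖ = 1 := Circle.norm_coe _

/-- The product of the three points. -/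
def p (k : TripleSpace) : ℂ := k.x * k.y * k.z

/-- The coordinate of weight two. -/
def u (k : TripleSpace) : ℂ := k.p * conj k.r

/-- The coordinate of weight three. -/
def v (k : TripleSpace) : ℂ := k.p + conj k.r ^ 3 * k.p ^ 2

theorem continuous_r : Continuous r := continuous_snd.comp continuous_subtype_val

theorem continuous_x : Continuous x :=
  continuous_subtype_val.comp
    (continuous_fst.comp (continuous_fst.comp continuous_subtype_val))

theorem continuous_y : Continuous y :=
  continuous_subtype_val.comp
    (continuous_fst.comp (continuous_snd.comp (continuous_fst.comp continuous_subtype_val)))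

theorem continuous_z : Continuous z :=
  continuous_subtype_val.comp
    (continuous_snd.comp (continuous_snd.comp (continuous_fst.comp continuous_subtype_val)))

theorem norm_r_le (k : TripleSpace) : ‖k.r‖ ≤ 1 := k.2.1

theorem two_mul_r_add (k : TripleSpace) : 2 * k.r + k.p * conj k.r ^ 2 = k.x + k.y + k.z := k.2.2

theorem norm_p (k : TripleSpace) : ‖k.p‖ = 1 := by simp [p]

theorem p_ne_zero (k : TripleSpace) : k.p ≠ 0 := Complex.ne_zero_of_norm_eq_one k.norm_p

theorem norm_u (k : TripleSpace) : ‖k.u‖ = ‖k.r‖ := by simp [u, norm_p]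

/-- The other root is `p² r̄³`, of modulus `‖r‖³ ≤ 1 = ‖p‖`. -/
theorem quadratic_p (k : TripleSpace) : k.p ^ 2 - k.v * k.p + k.u ^ 3 = 0 := by
  simp only [u, v]; ring

theorem continuous_p : Continuous p := by
  have := continuous_x
  have := continuous_y
  have := continuous_z
  unfold p
  fun_prop

theorem continuous_u : Continuous u := by
  have := continuous_p
  have := continuous_r
  unfold u
  fun_prop

theorem continuous_v : Continuous v := by
  have := continuous_p
  have := continuous_r
  unfold v
  fun_prop

/-- The underlying subset of the circle. -/
def subset (k : TripleSpace) : FiniteSubsetSpace 3 Circle :=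
  .triple k.1.1.1 k.1.1.2.1 k.1.1.2.2

theorem continuous_subset : Continuous subset :=
  FiniteSubsetSpace.continuous_triple (by fun_prop) (by fun_prop) (by fun_prop)

theorem subset_surjective : Function.Surjective subset := by
  intro S
  obtain ⟨x, y, z, rfl⟩ := S.exists_eq_triple
  obtain ⟨r, hr, h⟩ := exists_disc_point x.norm_coe y.norm_coe z.norm_coe
  exact ⟨⟨((x, y, z), r), hr, h⟩, rfl⟩

theorem subset_eq_iff (k l : TripleSpace) :
    k.subset = l.subset ↔ ({k.x, k.y, k.z} : Set ℂ) = {l.x, l.y, l.z} := by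
  have e (m : TripleSpace) : (fun w : Circle ↦ (w : ℂ)) '' m.subset.1 = {m.x, m.y, m.z} := by
    change (fun w : Circle ↦ (w : ℂ)) '' {m.1.1.1, m.1.1.2.1, m.1.1.2.2} = _
    rw [Set.image_insert_eq, Set.image_pair]
    rfl
  rw [← e, ← e]
  exact Subtype.ext_iff.trans (Set.image_injective.2 Circle.coe_injective).eq_iff.symm

/-! ### Fibres and range of the weighted coordinates -/

theorem r_eq_of_sum_prod_eq {k l : TripleSpace} (hp : k.p = l.p)
    (hs : k.x + k.y + k.z = l.x + l.y + l.z) : k.r = l.r := by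
  refine harmonic_injOn k.norm_p k.norm_r_le l.norm_r_le ?_
  rw [k.two_mul_r_add, hs, ← l.two_mul_r_add, hp]

theorem subset_eq_of_p_eq_of_r_eq {k l : TripleSpace} (hp : k.p = l.p) (hr : k.r = l.r) :
    k.subset = l.subset := by
  rw [subset_eq_iff]
  refine triple_eq_of_sum_prod_eq (by simp) (by simp) (by simp) (by simp) (by simp) (by simp) ?_ hp
  rw [← k.two_mul_r_add, ← l.two_mul_r_add, hp, hr]

/-- If the triple has the double point `a`, then its disc coordinate is `a`. -/
theorem uv_of_double {k : TripleSpace} {a b : ℂ} (ha : ‖a‖ = 1) (hp : k.p = a * a * b)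
    (hs : k.x + k.y + k.z = a + a + b) : k.u = a * b ∧ k.v = a * b * (a + b) := by
  have haa := Complex.conj_mul_self_of_norm_eq_one ha
  have hr : k.r = a := by
    refine harmonic_injOn k.norm_p k.norm_r_le ha.le ?_
    rw [k.two_mul_r_add, hs, hp]
    linear_combination -(b * (conj a * a + 1)) * haa
  rw [u, v, hr, hp]
  constructor
  · linear_combination a * b * haa
  · linear_combination a * b ^ 2 * ((conj a * a) ^ 2 + conj a * a + 1) * haa

theorem exists_pair_of_degenerate {k : TripleSpace} (h : k.x = k.y ∨ k.y = k.z ∨ k.x = k.z) :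
    ∃ a b : ℂ, ({k.x, k.y, k.z} : Set ℂ) = {a, b} ∧ k.u = a * b ∧ k.v = a * b * (a + b) := by
  rcases h with h | h | h
  · exact ⟨k.x, k.z, by rw [← h]; simp, uv_of_double k.norm_x (by rw [p, ← h]) (by rw [← h])⟩
  · exact ⟨k.y, k.x, by rw [← h, Set.pair_eq_singleton, Set.pair_comm],
      uv_of_double k.norm_y (by rw [p, ← h]; ring) (by rw [← h]; ring)⟩
  · exact ⟨k.x, k.y, by rw [← h, Set.pair_comm k.y, ← Set.insert_comm]; simp,
      uv_of_double k.norm_x (by rw [p, ← h]; ring) (by rw [← h]; ring)⟩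

theorem degenerate_of_eq_pair {x y z a b : ℂ} (h : ({x, y, z} : Set ℂ) = {a, b}) :
    x = y ∨ y = z ∨ x = z := by
  have hx : x ∈ ({a, b} : Set ℂ) := h ▸ (by simp)
  have hy : y ∈ ({a, b} : Set ℂ) := h ▸ (by simp)
  have hz : z ∈ ({a, b} : Set ℂ) := h ▸ (by simp)
  rcases hx with hx | hx <;> rcases hy with hy | hy <;> rcases hz with hz | hz <;>
    simp_all

theorem sum_prod_eq_of_triple_eq {x y z x' y' z' : ℂ} (h : ({x, y, z} : Set ℂ) = {x', y', z'})
    (hxy : x ≠ y) (hyz : y ≠ z) (hxz : x ≠ z) :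
    x + y + z = x' + y' + z' ∧ x * y * z = x' * y' * z' := by
  have hx : x ∈ ({x', y', z'} : Set ℂ) := h ▸ (by simp)
  have hy : y ∈ ({x', y', z'} : Set ℂ) := h ▸ (by simp)
  have hz : z ∈ ({x', y', z'} : Set ℂ) := h ▸ (by simp)
  rcases hx with hx | hx | hx <;> rcases hy with hy | hy | hy <;>
    first
    | exact absurd (hx.trans hy.symm) hxy
    | (rcases hz with hz | hz | hz <;>
      first
      | exact absurd (hx.trans hz.symm) hxz
      | exact absurd (hy.trans hz.symm) hyz
      | (rw [hx, hy, hz]; constructor <;> ring))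

/-- Three distinct points are determined up to order by their set. With a repetition the set forgets
which point is double, but `u = ab` and `v = ab(a + b)` are symmetric. -/
theorem uv_eq_of_subset_eq {k l : TripleSpace} (h : k.subset = l.subset) :
    k.u = l.u ∧ k.v = l.v := by
  rw [subset_eq_iff] at h
  by_cases hk : k.x = k.y ∨ k.y = k.z ∨ k.x = k.z
  · obtain ⟨a, b, hab, hu, hv⟩ := exists_pair_of_degenerate hk
    obtain ⟨a', b', hab', hu', hv'⟩ :=
      exists_pair_of_degenerate (degenerate_of_eq_pair (h.symm.trans hab))
    rw [hu, hv, hu', hv']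
    rcases Set.pair_eq_pair_iff.1 (hab.symm.trans (h.trans hab')) with ⟨rfl, rfl⟩ | ⟨rfl, rfl⟩
    · exact ⟨rfl, rfl⟩
    · constructor <;> ring
  · push Not at hk
    obtain ⟨hs, hp⟩ := sum_prod_eq_of_triple_eq h hk.1 hk.2.1 hk.2.2
    have hp' : k.p = l.p := hp
    rw [u, u, v, v, hp', r_eq_of_sum_prod_eq hp' hs]
    exact ⟨rfl, rfl⟩

/-- Two triples whose coordinates agree up to a weighted positive scaling have the same subset. -/
theorem subset_eq_of_scaling {k l : TripleSpace} {c : ℝ} (hc : 0 < c) (hu : l.u = c ^ 2 * k.u)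
    (hv : l.v = c ^ 3 * k.v) : k.subset = l.subset := by
  have hc0 : (c : ℂ) ≠ 0 := by exact_mod_cast hc.ne'
  set P := l.p / c ^ 3 with hP
  have hlP : l.p = c ^ 3 * P := by rw [hP]; field_simp
  have hPn : c ^ 3 * ‖P‖ = 1 := by
    have := l.norm_p
    rw [hlP] at this
    simpa [abs_of_pos hc] using this
  have hk := k.quadratic_p
  have hl : P ^ 2 - k.v * P + k.u ^ 3 = 0 := by
    have := l.quadratic_p
    rw [hu, hv, hlP] at this
    have h6 : (c : ℂ) ^ 6 ≠ 0 := pow_ne_zero _ hc0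
    apply mul_left_cancel₀ h6
    linear_combination this
  have hun : ‖k.u‖ ≤ 1 := k.norm_u.trans_le k.norm_r_le
  have hun' : c ^ 2 * ‖k.u‖ ≤ 1 := by
    have := l.norm_u.trans_le l.norm_r_le
    rw [hu] at this
    simpa [abs_of_pos hc] using this
  have hfac : (P - k.p) * (P + k.p - k.v) = 0 := by linear_combination hl - hk
  have hone : c ^ 3 = 1 → c = 1 := fun h ↦ (pow_eq_one_iff_of_nonneg hc.le three_ne_zero).1 h
  -- `P`, the rescaled product of `l`, is either the root `k.p` or the other root of the same
  -- quadratic.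
  rcases mul_eq_zero.1 hfac with h | h
  · have hPk : P = k.p := sub_eq_zero.1 h
    have hc1 : c = 1 := hone (by rw [hPk, k.norm_p] at hPn; linarith)
    rw [hc1] at hu hlP
    have hp : k.p = l.p := by rw [hlP, hPk]; simp
    refine subset_eq_of_p_eq_of_r_eq hp ?_
    have hu' : l.p * conj l.r = k.p * conj k.r := by
      have : l.u = k.u := by simpa using hu
      exact this
    rw [hp] at hu'
    exact ((starRingEnd ℂ).injective (mul_left_cancel₀ l.p_ne_zero hu')).symm
  -- For the other root, `‖P‖ = ‖k.u‖³ ≤ 1` gives `c ≥ 1` and `‖l.u‖ ≤ 1` gives `c ≤ 1`; so `c = 1`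
  -- and both triples lie on the boundary.
  · have hprod : P * k.p = k.u ^ 3 := by linear_combination k.p * h - hk
    have hPu : ‖P‖ = ‖k.u‖ ^ 3 := by
      have := congrArg norm hprod
      simpa [norm_p] using this
    have hP1 : ‖P‖ ≤ 1 := by
      rw [hPu]; exact pow_le_one₀ (norm_nonneg _) hun
    have hP2 : c ^ 3 ≤ 1 := by
      have h1 : (c ^ 2 * ‖k.u‖) ^ 3 ≤ 1 := pow_le_one₀ (by positivity) hun'
      have h2 : (c ^ 2 * ‖k.u‖) ^ 3 = c ^ 3 * (c ^ 3 * ‖P‖) := by rw [hPu]; ring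
      rwa [h2, hPn, mul_one] at h1
    have hc3 : c ^ 3 = 1 := by nlinarith [mul_le_mul_of_nonneg_left hP1 (pow_pos hc 3).le]
    have hc1 : c = 1 := hone hc3
    rw [hc1] at hu hlP hPn
    have hlP' : l.p = P := by simpa using hlP
    have hu' : l.u = k.u := by simpa using hu
    have hu1 : ‖k.u‖ = 1 := by
      refine (pow_eq_one_iff_of_nonneg (norm_nonneg _) three_ne_zero).1 ?_
      rw [← hPu]; simpa using hPn
    have hkr : ‖k.r‖ = 1 := by rw [← norm_u, hu1]
    have hlr : ‖l.r‖ = 1 := by rw [← norm_u, hu', hu1]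
    have hkk := Complex.conj_mul_self_of_norm_eq_one hkr
    have hll := Complex.conj_mul_self_of_norm_eq_one hlr
    -- The double point of each triple is the remaining point of the other.
    have ek : l.r = k.p * conj k.r ^ 2 := by
      have h1 : l.p * conj l.r = k.p * conj k.r := hu'
      have h2 : l.p * k.p = (k.p * conj k.r) ^ 3 := by rw [hlP', hprod]; rfl
      have h3 : k.p * conj k.r * l.r = l.p := by rw [← h1]; linear_combination l.p * hll
      have h4 : conj k.r ≠ 0 := fun h ↦ by simp [h] at hkk
      have h5 : k.p ^ 2 * conj k.r ≠ 0 := mul_ne_zero (pow_ne_zero _ k.p_ne_zero) h4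
      apply mul_left_cancel₀ h5
      linear_combination k.p * h3 + h2
    have el : k.r = l.p * conj l.r ^ 2 := by
      have h1 : l.p * conj l.r = k.p * conj k.r := hu'
      have h2 : conj l.r = conj k.p * k.r ^ 2 := by rw [ek]; simp
      have h3 := Complex.conj_mul_self_of_norm_eq_one k.norm_p
      rw [sq, ← mul_assoc, h1, h2]
      linear_combination -k.r * hkk - k.r * (conj k.r * k.r) * h3
    rw [subset_eq_iff, triple_eq_pair_of_norm_eq_one (by simp) (by simp) (by simp) hkr
      k.two_mul_r_add, triple_eq_pair_of_norm_eq_one (by simp) (by simp) (by simp) hlr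
      l.two_mul_r_add]
    change ({k.r, k.p * conj k.r ^ 2} : Set ℂ) = {l.r, l.p * conj l.r ^ 2}
    rw [← ek, ← el, Set.pair_comm]

/-- Every nonzero pair is a weighted rescaling of the coordinates of a triple. -/
theorem exists_scaling {a b : ℂ} (h : a ≠ 0 ∨ b ≠ 0) :
    ∃ (k : TripleSpace) (c : ℝ), 0 < c ∧ a = c ^ 2 * k.u ∧ b = c ^ 3 * k.v := by
  -- Taking `P` to be a root of largest modulus makes `‖a‖³ ≤ ‖P‖²`, which keeps the disc coordinate
  -- in the unit disc.
  obtain ⟨P, Q, hsum, hprod, hle⟩ : ∃ P Q : ℂ, P + Q = b ∧ P * Q = a ^ 3 ∧ ‖Q‖ ≤ ‖P‖ := by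
    obtain ⟨P, hP⟩ : ∃ x : ℂ, x ^ 2 - b * x + a ^ 3 = 0 := by
      have hd : (Polynomial.X ^ 2 - Polynomial.C b * Polynomial.X +
          Polynomial.C (a ^ 3) : Polynomial ℂ).degree = 2 := by
        compute_degree!
      obtain ⟨x, hx⟩ := IsAlgClosed.exists_root _ (hd.trans_ne (by decide))
      exact ⟨x, by simpa [Polynomial.IsRoot] using hx⟩
    rcases le_total ‖b - P‖ ‖P‖ with hle | hle
    · exact ⟨P, b - P, by ring, by linear_combination -hP, hle⟩
    · exact ⟨b - P, P, by ring, by linear_combination -hP, hle⟩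
  have hP0 : P ≠ 0 := by
    rintro rfl
    have hQ : Q = 0 := by simpa using hle
    subst hQ
    rcases h with h | h
    · exact h (by simpa using hprod.symm)
    · exact h (by simpa using hsum.symm)
  have hPn : 0 < ‖P‖ := norm_pos_iff.2 hP0
  set c := ‖P‖ ^ ((3 : ℕ) : ℝ)⁻¹ with hc
  have hcp : 0 < c := Real.rpow_pos_of_pos hPn _
  have hc3 : c ^ 3 = ‖P‖ := Real.rpow_inv_natCast_pow hPn.le three_ne_zero
  have hc0 : (c : ℂ) ≠ 0 := by exact_mod_cast hcp.ne'
  set p := P / c ^ 3 with hp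
  have hpn : ‖p‖ = 1 := by
    rw [hp, norm_div, norm_pow, Complex.norm_real, Real.norm_of_nonneg hcp.le, hc3,
      div_self hPn.ne']
  have hp0 : p ≠ 0 := Complex.ne_zero_of_norm_eq_one hpn
  -- Forced by `a = c² u` and `u = p r̄`: the disc coordinate must be `conj q`.
  set q := a / (c ^ 2 * p) with hq
  have han : ‖a‖ ≤ c ^ 2 := by
    refine le_of_pow_le_pow_left₀ three_ne_zero (by positivity) ?_
    calc ‖a‖ ^ 3 = ‖P‖ * ‖Q‖ := by rw [← norm_pow, ← hprod, norm_mul]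
      _ ≤ ‖P‖ * ‖P‖ := by gcongr
      _ = (c ^ 2) ^ 3 := by rw [← hc3]; ring
  have hqn : ‖q‖ ≤ 1 := by
    rw [hq, norm_div, norm_mul, hpn, norm_pow, Complex.norm_real, Real.norm_of_nonneg hcp.le,
      mul_one]
    exact div_le_one_of_le₀ han (by positivity)
  obtain ⟨x, y, z, hx, hy, hz, hxyz, hr⟩ := exists_circle_points hpn (r := conj q) (by simpa)
  refine ⟨⟨((⟨x, mem_sphere_zero_iff_norm.2 hx⟩, ⟨y, mem_sphere_zero_iff_norm.2 hy⟩,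
    ⟨z, mem_sphere_zero_iff_norm.2 hz⟩), conj q), by simpa, ?_⟩, c, hcp, ?_, ?_⟩
  · change 2 * conj q + x * y * z * conj (conj q) ^ 2 = x + y + z
    rw [hxyz, hr]
  · change a = c ^ 2 * (x * y * z * conj (conj q))
    rw [hxyz, Complex.conj_conj, hq]
    field_simp
  · change b = c ^ 3 * (x * y * z + conj (conj q) ^ 3 * (x * y * z) ^ 2)
    rw [hxyz, Complex.conj_conj, ← hsum]
    have hQ : Q = a ^ 3 / P := by rw [← hprod]; field_simp
    rw [hQ, hq, hp]
    field_simp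

/-! ### From weighted rays to the three-sphere -/

/-- Real coordinates on `ℂ × ℂ`. -/
noncomputable def realCoords (a b : ℂ) : EuclideanSpace ℝ (Fin 4) := !₂[a.re, a.im, b.re, b.im]

theorem realCoords_eq_iff {a b a' b' : ℂ} :
    realCoords a b = realCoords a' b' ↔ a = a' ∧ b = b' := by
  constructor
  · intro h
    have h0 := congrArg (fun e : EuclideanSpace ℝ (Fin 4) ↦ e 0) h
    have h1 := congrArg (fun e : EuclideanSpace ℝ (Fin 4) ↦ e 1) h
    have h2 := congrArg (fun e : EuclideanSpace ℝ (Fin 4) ↦ e 2) h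
    have h3 := congrArg (fun e : EuclideanSpace ℝ (Fin 4) ↦ e 3) h
    simp only [realCoords] at h0 h1 h2 h3
    exact ⟨Complex.ext h0 h1, Complex.ext h2 h3⟩
  · rintro ⟨rfl, rfl⟩; rfl

theorem smul_realCoords (c : ℝ) (a b : ℂ) :
    c • realCoords a b = realCoords (c * a) (c * b) := by
  ext i
  fin_cases i <;> simp [realCoords]

theorem realCoords_surjective (e : EuclideanSpace ℝ (Fin 4)) : ∃ a b, realCoords a b = e := by
  refine ⟨⟨e 0, e 1⟩, ⟨e 2, e 3⟩, ?_⟩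
  ext i
  fin_cases i <;> simp [realCoords]

/-- The coordinates of a triple, made homogeneous of weight six. -/
noncomputable def vec (k : TripleSpace) : EuclideanSpace ℝ (Fin 4) :=
  realCoords (k.u * (‖k.u‖ : ℂ) ^ 2) (k.v * (‖k.v‖ : ℂ) ^ 1)

theorem continuous_vec : Continuous vec := by
  have hu : Continuous fun k : TripleSpace ↦ k.u * (‖k.u‖ : ℂ) ^ 2 :=
    continuous_u.mul ((Complex.continuous_ofReal.comp continuous_u.norm).pow 2)
  have hv : Continuous fun k : TripleSpace ↦ k.v * (‖k.v‖ : ℂ) ^ 1 :=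
    continuous_v.mul ((Complex.continuous_ofReal.comp continuous_v.norm).pow 1)
  refine (PiLp.continuous_toLp 2 _).comp (continuous_pi fun i ↦ ?_)
  fin_cases i
  · exact Complex.continuous_re.comp hu
  · exact Complex.continuous_im.comp hu
  · exact Complex.continuous_re.comp hv
  · exact Complex.continuous_im.comp hv

theorem vec_ne_zero (k : TripleSpace) : k.vec ≠ 0 := by
  intro h
  have h0 : realCoords 0 0 = 0 := by ext i; fin_cases i <;> simp [realCoords]
  rw [← h0, vec, realCoords_eq_iff] at h
  have hu : k.u = 0 := by simpa using h.1
  have hv : k.v = 0 := by simpa using h.2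
  have := k.quadratic_p
  rw [hu, hv] at this
  exact k.p_ne_zero (by simpa using this)

/-- The point of the three-sphere attached to a triple. -/
noncomputable def toSphere (k : TripleSpace) : Metric.sphere (0 : EuclideanSpace ℝ (Fin 4)) 1 :=
  ⟨‖k.vec‖⁻¹ • k.vec, by simp [norm_smul, k.vec_ne_zero]⟩

theorem continuous_toSphere : Continuous toSphere :=
  ((continuous_vec.norm.inv₀ fun k ↦ norm_ne_zero_iff.2 k.vec_ne_zero).smul
    continuous_vec).subtype_mk _

theorem eq_scaling_of_weight_six {c : ℝ} (hc : 0 < c) {u v u' v' : ℂ}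
    (hu : u' * (‖u'‖ : ℂ) ^ 2 = (c ^ 6 : ℝ) * (u * (‖u‖ : ℂ) ^ 2))
    (hv : v' * (‖v'‖ : ℂ) ^ 1 = (c ^ 6 : ℝ) * (v * (‖v‖ : ℂ) ^ 1)) :
    u' = c ^ 2 * u ∧ v' = c ^ 3 * v := by
  constructor
  · apply mul_norm_pow_injective 2
    simp only [hu, norm_mul, norm_pow, Complex.norm_real, Real.norm_of_nonneg hc.le]
    push_cast; ring
  · apply mul_norm_pow_injective 1
    simp only [hv, norm_mul, norm_pow, Complex.norm_real, Real.norm_of_nonneg hc.le]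
    push_cast; ring

theorem exists_pow_six {c : ℝ} (hc : 0 < c) : ∃ d : ℝ, 0 < d ∧ d ^ 6 = c :=
  ⟨c ^ ((6 : ℕ) : ℝ)⁻¹, Real.rpow_pos_of_pos hc _, Real.rpow_inv_natCast_pow hc.le (by simp)⟩

theorem toSphere_eq_iff (k l : TripleSpace) : k.subset = l.subset ↔ k.toSphere = l.toSphere := by
  constructor
  · intro h
    obtain ⟨hu, hv⟩ := uv_eq_of_subset_eq h
    apply Subtype.ext
    simp only [toSphere, vec, hu, hv]
  · intro h
    have h' : ‖k.vec‖⁻¹ • k.vec = ‖l.vec‖⁻¹ • l.vec := congrArg Subtype.val h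
    have hk : 0 < ‖k.vec‖ := norm_pos_iff.2 k.vec_ne_zero
    have hl : 0 < ‖l.vec‖ := norm_pos_iff.2 l.vec_ne_zero
    obtain ⟨c, hc, hc6⟩ := exists_pow_six (div_pos hl hk)
    have hvec : l.vec = c ^ 6 • k.vec := by
      rw [hc6, div_eq_mul_inv, mul_smul, h', smul_smul, mul_inv_cancel₀ hl.ne', one_smul]
    rw [vec, vec, smul_realCoords, realCoords_eq_iff] at hvec
    obtain ⟨hu, hv⟩ := eq_scaling_of_weight_six hc hvec.1 hvec.2
    exact subset_eq_of_scaling hc hu hv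

theorem toSphere_surjective : Function.Surjective toSphere := by
  rintro ⟨e, he⟩
  rw [mem_sphere_zero_iff_norm] at he
  obtain ⟨a, b, rfl⟩ := realCoords_surjective e
  obtain ⟨a', rfl⟩ := mul_norm_pow_surjective 2 a
  obtain ⟨b', rfl⟩ := mul_norm_pow_surjective 1 b
  have hne : a' ≠ 0 ∨ b' ≠ 0 := by
    by_contra! h
    have h0 : realCoords 0 0 = 0 := by ext i; fin_cases i <;> simp [realCoords]
    simp [h.1, h.2, h0] at he
  obtain ⟨k, c, hc, ha, hb⟩ := exists_scaling hne
  have hvec : realCoords (a' * (‖a'‖ : ℂ) ^ 2) (b' * (‖b'‖ : ℂ) ^ 1) = c ^ 6 • k.vec := by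
    rw [vec, smul_realCoords, realCoords_eq_iff, ha, hb]
    simp only [norm_mul, norm_pow, Complex.norm_real, Real.norm_of_nonneg hc.le]
    push_cast
    constructor <;> ring
  refine ⟨k, Subtype.ext ?_⟩
  simp only at he ⊢
  rw [hvec] at he ⊢
  rw [norm_smul, Real.norm_of_nonneg (by positivity)] at he
  simp only [toSphere]
  rw [eq_inv_of_mul_eq_one_left he]

end TripleSpace

theorem mainTheorem2 :
    Nonempty (FiniteSubsetSpace 3 Circle ≃ₜ
      Metric.sphere (0 : EuclideanSpace ℝ (Fin 4)) 1) :=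
  nonempty_homeomorph_of_same_fibres TripleSpace.continuous_subset TripleSpace.continuous_toSphere
    TripleSpace.subset_surjective TripleSpace.toSphere_surjective TripleSpace.toSphere_eq_iff
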